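/- (Throughout, natural numbers include $0$.) There is a single polynomial $$F(y,n,s,x,w,k,l,m,i,j,v_1,v_2,v_3)$$ with integer coefficients in $13$ variables such that, for all natural numbers $y,n,s$ with $n\ge s>0$, the relation $y=\binom{n}{s}$ holds if and only if there are natural numbers $x,w,k,l,m,i,j,v_1,v_2,v_3$ with $$F(y,n,s,x,w,k,l,m,i,j,v_1,v_2,v_3)=0.$$ That is, the binomial coefficient has a Diophantine representation with parameters $y,n,s$ and only $10$ unknowns. -/

import Mathlib

/-!
The binomial coefficient `n.choose s` is the digit of `(U + 1) ^ n` at `U ^ s` in any base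
`U > 2 ^ n`, so it is the residue modulo `U` of the integer part of `(U + 1) ^ n / U ^ s`. Let
`y_a(k)` be the `k`-th solution of `x ^ 2 - (a ^ 2 - 1) * y ^ 2 = 1`; it is close to
`(2 * a) ^ (k - 1)` for large `a`. Hence, for `M` huge compared with `U` and `n`, the fraction
`y_{M (U + 1)}(n + 1) / (y_M(n - s + 1) * y_{M U}(s + 1))` has the same integer part as
`(U + 1) ^ n / U ^ s`, and no exponential has to be written down.

Only the first of the three Pell solutions is identified by the Matiyasevich–Robinson method, which
requires a single number to be a square. The inequalities for the quotient bound the other two, so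
that their residues modulo `a - 1` determine their indices. That `M` and `U` are large enough also
follows from Pell equations: a positive solution `y_a(k)` divisible by `a - 1` has `a - 1 ∣ k` and
is thus at least `a ^ (a - 2)`.

What remains is that four numbers are squares and one number is positive. A single unknown `z`
expresses that two positive numbers `a`, `b` are squares, as a root of the product of the four
`z ± √a ± (a + 1) √b`; replacing `z` by a multiple of `2 t - 1` minus a natural number expresses
`0 < t` as well.
-/

open Pell

/-- For natural `a > 1` this is a square exactly if `|c|` is the second component of a solution of
the Pell equation `x ^ 2 - (a ^ 2 - 1) * y ^ 2 = 1`. -/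
def pellForm {R : Type*} [CommRing R] (a c : R) : R := (a ^ 2 - 1) * c ^ 2 + 1

theorem map_pellForm {R S : Type*} [CommRing R] [CommRing S] (φ : R →+* S) (a c : R) :
    φ (pellForm a c) = pellForm (φ a) (φ c) := by
  simp [pellForm]

theorem pellForm_pos {a : ℤ} (ha : 1 ≤ a) (c : ℤ) : 0 < pellForm a c := by
  have h : 0 ≤ a ^ 2 - 1 := by nlinarith
  unfold pellForm
  positivity

theorem pellForm_modEq {a a' c c' m : ℤ} (ha : a ≡ a' [ZMOD m]) (hc : c ≡ c' [ZMOD m]) :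
    pellForm a c ≡ pellForm a' c' [ZMOD m] :=
  (((ha.pow 2).sub_right 1).mul (hc.pow 2)).add_right 1

theorem pellForm_modEq_one (a : ℤ) {c m : ℤ} (h : m ∣ c) : pellForm a c ≡ 1 [ZMOD m] := by
  simpa [pellForm] using pellForm_modEq (Int.ModEq.refl a) (Int.modEq_zero_iff_dvd.mpr h)

section Solutions

variable {a g : ℕ} (a1 : 1 < a) (g1 : 1 < g)

theorem xn_sq_eq_pellForm (k : ℕ) : (xn a1 k : ℤ) ^ 2 = pellForm (a : ℤ) (yn a1 k) := by
  have h := pell_eqz a1 k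
  rw [dz_val] at h
  simp only [xz, yz, az] at h
  unfold pellForm
  linarith

theorem isSquare_pellForm_iff {c : ℤ} : IsSquare (pellForm (a : ℤ) c) ↔ ∃ k, |c| = yn a1 k := by
  constructor
  · rintro ⟨x, hx⟩
    obtain ⟨k, -, hk⟩ := eq_pell a1 <| (isPell_nat a1 (x := x.natAbs) (y := c.natAbs)).mp <| by
      change (x.natAbs : ℤ) * x.natAbs - _ * c.natAbs * c.natAbs = 1
      rw [dz_val, az, mul_assoc, Int.natAbs_mul_self', Int.natAbs_mul_self', ← hx, pellForm]
      ring
    exact ⟨k, by rw [← hk, Int.natCast_natAbs]⟩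
  · rintro ⟨k, hk⟩
    exact ⟨xn a1 k, by rw [← sq, xn_sq_eq_pellForm, ← hk, pellForm, pellForm, sq_abs]⟩

theorem isSquare_pellForm_yn (k : ℕ) : IsSquare (pellForm (a : ℤ) (yn a1 k)) :=
  (isSquare_pellForm_iff a1).mpr ⟨k, Nat.abs_cast _⟩

theorem yn_pos {k : ℕ} (hk : 0 < k) : 0 < yn a1 k := hk.trans_le (yn_ge_n a1 k)

theorem pow_le_yn_succ (n : ℕ) : (2 * a - 1 : ℤ) ^ n ≤ yn a1 (n + 1) := by
  induction n with
  | zero => simp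
  | succ n ih =>
    have hrec : (yn a1 (n + 2) : ℤ) + yn a1 n = 2 * a * yn a1 (n + 1) := by
      exact_mod_cast yn_succ_succ a1 n
    have hmono : (yn a1 n : ℤ) ≤ yn a1 (n + 1) := by
      exact_mod_cast (strictMono_y a1).monotone n.le_succ
    calc (2 * a - 1 : ℤ) ^ (n + 1) = (2 * a - 1) ^ n * (2 * a - 1) := pow_succ _ n
      _ ≤ yn a1 (n + 1) * (2 * a - 1) := by gcongr; omega
      _ ≤ yn a1 (n + 2) := by linarith

theorem yn_succ_le_pow (n : ℕ) : yn a1 (n + 1) ≤ (2 * a) ^ n := by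
  induction n with
  | zero => simp
  | succ n ih =>
    calc yn a1 (n + 2) ≤ 2 * a * yn a1 (n + 1) := yn_succ_succ a1 n ▸ Nat.le_add_right _ _
      _ ≤ 2 * a * (2 * a) ^ n := by gcongr
      _ = (2 * a) ^ (n + 1) := (pow_succ' _ n).symm

theorem base_pow_le_yn_succ (n : ℕ) : a ^ n ≤ yn a1 (n + 1) := by
  have h : (a : ℤ) ^ n ≤ (2 * a - 1) ^ n := by gcongr; omega
  exact_mod_cast h.trans (pow_le_yn_succ a1 n)

theorem yn_le_yn (h : a ≤ g) (n : ℕ) : yn a1 n ≤ yn g1 n := by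
  suffices xn a1 n ≤ xn g1 n ∧ yn a1 n ≤ yn g1 n from this.2
  induction n with
  | zero => simp
  | succ n ih =>
    obtain ⟨hx, hy⟩ := ih
    have hd : a * a - 1 ≤ g * g - 1 := Nat.sub_le_sub_right (Nat.mul_le_mul h h) 1
    rw [xn_succ, xn_succ, yn_succ, yn_succ]
    exact ⟨add_le_add (Nat.mul_le_mul hx h) (Nat.mul_le_mul hd hy),
      add_le_add hx (Nat.mul_le_mul hy h)⟩

theorem xn_two_mul (k : ℕ) : (xn a1 (2 * k) : ℤ) = 2 * pellForm (a : ℤ) (yn a1 k) - 1 := by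
  have hadd := xn_add a1 k k
  have hpell := pell_eqz a1 k
  simp only [xz, yz] at hpell
  rw [← two_mul] at hadd
  rw [← xn_sq_eq_pellForm, hadd]
  push_cast
  linarith

theorem yn_two_mul (k : ℕ) : yn a1 (2 * k) = 2 * xn a1 k * yn a1 k := by
  rw [two_mul k, yn_add]
  ring

theorem yn_modEq_index (k : ℕ) : (yn a1 k : ℤ) ≡ k [ZMOD (a : ℤ) - 1] := by
  simpa [Nat.cast_sub a1.le] using Int.natCast_modEq_iff.mpr (yn_modEq_a_sub_one a1 k)

theorem yn_modEq_yn {m : ℤ} (h : (a : ℤ) ≡ g [ZMOD m]) (k : ℕ) :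
    (yn a1 k : ℤ) ≡ yn g1 k [ZMOD m] := by
  rw [← Int.modEq_natAbs, Int.natCast_modEq_iff] at *
  exact (xy_modEq_of_modEq a1 g1 h k).2

theorem modEq_or_modEq_neg_of_yn_sq_modEq {i j n : ℕ} (hi : 0 < i) (hin : 2 * i ≤ n)
    (h : (yn a1 j : ℤ) ^ 2 ≡ yn a1 i ^ 2 [ZMOD xn a1 n]) :
    (j : ℤ) ≡ i [ZMOD 2 * n] ∨ (j : ℤ) ≡ -i [ZMOD 2 * n] := by
  have hx : xn a1 (2 * j) ≡ xn a1 (2 * i) [MOD xn a1 n] := by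
    rw [← Int.natCast_modEq_iff, xn_two_mul, xn_two_mul]
    exact (((h.mul_left _).add_right 1).mul_left 2).sub_right 1
  refine (modEq_of_xn_modEq a1 (by omega) hin hx).imp (fun h => ?_) fun h => ?_ <;>
    refine Int.ModEq.mul_left_cancel' two_ne_zero ?_ <;>
    have := Int.natCast_modEq_iff.mpr h <;>
    rw [Int.modEq_iff_dvd] at this ⊢ <;>
    convert this using 1 <;> push_cast <;> ring

end Solutions

theorem eq_of_modEq_or_modEq_neg {x y c : ℤ} (hx : 0 < x) (hxc : x ≤ c) (hy : 0 < y) (hyc : y ≤ c)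
    (h : x ≡ y [ZMOD 2 * c] ∨ x ≡ -y [ZMOD 2 * c]) : x = y := by
  rcases h with h | h
  · have := Int.eq_zero_of_abs_lt_dvd h.dvd (by rw [abs_lt]; constructor <;> linarith)
    linarith
  · have := Int.le_of_dvd (by linarith) h.symm.dvd
    linarith

theorem isSquare_mul_iff_of_isCoprime {a b : ℤ} (ha : 0 < a) (hb : 0 < b) (h : IsCoprime a b) :
    IsSquare (a * b) ↔ IsSquare a ∧ IsSquare b := by
  have isSquare_left {u v c : ℤ} (hu : 0 < u) (huv : IsCoprime u v) (hc : u * v = c * c) :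
      IsSquare u := by
    obtain ⟨r, hr | hr⟩ := Int.sq_of_isCoprime huv (hc.trans (sq c).symm)
    · exact ⟨r, hr.trans (sq r)⟩
    · nlinarith [sq_nonneg r]
  refine ⟨fun ⟨c, hc⟩ => ⟨isSquare_left ha h hc, ?_⟩, fun ⟨ha', hb'⟩ => ha'.mul hb'⟩
  exact isSquare_left hb h.symm ((mul_comm b a).trans hc)

theorem isCoprime_of_modEq {u v w : ℤ} (h : IsCoprime u v) (hwv : w ≡ v [ZMOD u]) :
    IsCoprime u w := by
  obtain ⟨e, he⟩ := hwv.symm.dvd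
  rw [show w = v + u * e by linarith]
  exact h.add_mul_left_right e

theorem isCoprime_of_modEq_one {u v : ℤ} (h : v ≡ 1 [ZMOD u]) : IsCoprime u v :=
  isCoprime_of_modEq isCoprime_one_right h

section IndexForm

variable {R S : Type*} [CommRing R] [CommRing S]

/-- If this is the square `x ^ 2` for `c = y_a(k)`, then `x = x_a(n)` with `y_a(2 k) ^ 2 ∣ y_a(n)`,
so that `n` is a multiple of `c`; the residue of `y_a(j)` modulo `x_a(n)` then determines `j`
modulo `2 c` up to sign. -/
def periodForm (a c i : R) : R := pellForm a (4 * pellForm a c * c ^ 2 * (i + 1))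

/-- A second Pell base, congruent to `a` modulo `f` and to `1` modulo every divisor of `f - 1`. -/
def shiftedBase (a f : R) : R := a + f * (f - a)

/-- The general form of a number congruent to `c` modulo `f` and to `b` modulo `2 c`, where
`f ≡ 1` modulo `2 c`. -/
def shiftedIndex (b c f j : R) : R := c + f * (b - c) + 2 * c * f * j

/-- The Matiyasevich–Robinson form of the relation `c = y_a(b)`: for `0 < b ≤ c` it holds if and
only if this is a square for some `i` and `j`. The three factors are pairwise coprime. -/
def indexForm (a b c i j : R) : R :=
  pellForm a c * (periodForm a c i *
    pellForm (shiftedBase a (periodForm a c i)) (shiftedIndex b c (periodForm a c i) j))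

theorem map_indexForm (φ : R →+* S) (a b c i j : R) :
    φ (indexForm a b c i j) = indexForm (φ a) (φ b) (φ c) (φ i) (φ j) := by
  have h2 : φ 2 = 2 := map_ofNat φ 2
  have h4 : φ 4 = 4 := map_ofNat φ 4
  simp [indexForm, shiftedIndex, shiftedBase, periodForm, map_pellForm, h2, h4]

end IndexForm

theorem shiftedBase_modEq (a f : ℤ) : shiftedBase a f ≡ a [ZMOD f] := by
  simp [Int.modEq_iff_dvd, shiftedBase]

theorem shiftedBase_modEq_one (a : ℤ) {f m : ℤ} (h : f ≡ 1 [ZMOD m]) :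
    shiftedBase a f ≡ 1 [ZMOD m] := by
  simpa [shiftedBase] using (h.mul (h.sub_right a)).add_left a

theorem shiftedIndex_modEq (b c f j : ℤ) : shiftedIndex b c f j ≡ c [ZMOD f] := by
  rw [Int.modEq_iff_dvd, shiftedIndex]
  exact ⟨c - b - 2 * c * j, by ring⟩

theorem shiftedIndex_modEq_of_modEq_one (b j : ℤ) {c f : ℤ} (h : f ≡ 1 [ZMOD 2 * c]) :
    shiftedIndex b c f j ≡ b [ZMOD 2 * c] := by
  have h0 : 2 * c * f * j ≡ 0 [ZMOD 2 * c] := Int.modEq_zero_iff_dvd.mpr ⟨f * j, by ring⟩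
  simpa [shiftedIndex] using ((h.mul_right (b - c)).add_left c).add h0

theorem exists_shiftedIndex_eq {b c f z : ℤ} (hc : 0 < c) (hf : 0 < f) (hbc : b ≤ c) (hcz : c ≤ z)
    (hfc : f ≡ 1 [ZMOD 2 * c]) (hzf : z ≡ c [ZMOD f]) (hzc : z ≡ b [ZMOD 2 * c]) :
    ∃ j : ℕ, shiftedIndex b c f j = z := by
  have hdvd : 2 * c * f ∣ z - (c + f * (b - c)) := by
    apply (isCoprime_of_modEq_one hfc).mul_dvd
    · simpa [shiftedIndex] using ((shiftedIndex_modEq_of_modEq_one b 0 hfc).trans hzc.symm).dvd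
    · simpa [shiftedIndex] using ((shiftedIndex_modEq b c f 0).trans hzf.symm).dvd
  obtain ⟨j, hj⟩ := hdvd
  have hj0 : 0 ≤ 2 * c * f * j := by nlinarith
  lift j to ℕ using nonneg_of_mul_nonneg_right hj0 (by positivity)
  exact ⟨j, by rw [shiftedIndex]; linarith⟩

theorem add_le_shiftedBase {a f : ℤ} (ha : 0 ≤ a) (hf : a + 1 ≤ f) : a + f ≤ shiftedBase a f := by
  unfold shiftedBase
  nlinarith

theorem add_one_le_periodForm {a c i : ℤ} (ha : 1 < a) (hc : 1 ≤ c) (hi : 0 ≤ i) :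
    a + 1 ≤ periodForm a c i := by
  have hD := pellForm_pos ha.le c
  have he : 0 < 4 * pellForm a c * c ^ 2 * (i + 1) := by positivity
  unfold periodForm
  generalize 4 * pellForm a c * c ^ 2 * (i + 1) = e at he
  have h1 : 1 ≤ e ^ 2 := by nlinarith
  have h2 : a ≤ a ^ 2 - 1 := by nlinarith
  unfold pellForm
  nlinarith

theorem lt_shiftedBase_periodForm {a c i : ℤ} (ha : 1 < a) (hc : 1 ≤ c) (hi : 0 ≤ i) :
    a < shiftedBase a (periodForm a c i) := by
  have hF := add_one_le_periodForm ha hc hi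
  linarith [add_le_shiftedBase (by linarith) hF]

theorem indexForm_pos {a b c i j : ℤ} (ha : 1 < a) (hc : 1 ≤ c) (hi : 0 ≤ i) :
    0 < indexForm a b c i j := by
  have hF := add_one_le_periodForm ha hc hi
  have hG := lt_shiftedBase_periodForm ha hc hi
  exact mul_pos (pellForm_pos ha.le c) (mul_pos (by linarith) (pellForm_pos (by linarith) _))

theorem periodForm_modEq_one_pellForm (a c i : ℤ) : periodForm a c i ≡ 1 [ZMOD pellForm a c] :=
  pellForm_modEq_one a ⟨4 * c ^ 2 * (i + 1), by ring⟩

theorem periodForm_modEq_one_two_mul (a c i : ℤ) : periodForm a c i ≡ 1 [ZMOD 2 * c] :=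
  pellForm_modEq_one a ⟨2 * pellForm a c * c * (i + 1), by ring⟩

theorem isSquare_indexForm_iff {a b c i j : ℤ} (ha : 1 < a) (hc : 1 ≤ c) (hi : 0 ≤ i) :
    IsSquare (indexForm a b c i j) ↔ IsSquare (pellForm a c) ∧ IsSquare (periodForm a c i) ∧
      IsSquare (pellForm (shiftedBase a (periodForm a c i))
        (shiftedIndex b c (periodForm a c i) j)) := by
  have hD := pellForm_pos ha.le c
  have hF := add_one_le_periodForm ha hc hi
  have hG := lt_shiftedBase_periodForm ha hc hi
  have hFD := periodForm_modEq_one_pellForm a c i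
  unfold indexForm
  generalize periodForm a c i = f at *
  have hI := pellForm_pos (ha.le.trans hG.le) (shiftedIndex b c f j)
  have hDF : IsCoprime (pellForm a c) f := isCoprime_of_modEq_one hFD
  have hDI : IsCoprime (pellForm a c) (pellForm (shiftedBase a f) (shiftedIndex b c f j)) := by
    apply isCoprime_of_modEq_one
    simpa [pellForm] using pellForm_modEq (shiftedBase_modEq_one a hFD) (Int.ModEq.refl _)
  have hFI : IsCoprime f (pellForm (shiftedBase a f) (shiftedIndex b c f j)) :=
    isCoprime_of_modEq hDF.symm <|
      pellForm_modEq (shiftedBase_modEq a f) (shiftedIndex_modEq b c f j)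
  rw [isSquare_mul_iff_of_isCoprime hD (mul_pos (by linarith) hI) (hDF.mul_right hDI),
    isSquare_mul_iff_of_isCoprime (by linarith) hI hFI]

section Solutions

variable {a g : ℕ} (a1 : 1 < a) (g1 : 1 < g)

theorem four_mul_pellForm_mul_yn_sq (k : ℕ) :
    4 * pellForm (a : ℤ) (yn a1 k) * yn a1 k ^ 2 = yn a1 (2 * k) ^ 2 := by
  rw [← xn_sq_eq_pellForm, yn_two_mul]
  push_cast
  ring

theorem exists_index_of_isSquare_periodForm {k i : ℕ} (hk : 0 < k)
    (h : IsSquare (periodForm (a : ℤ) (yn a1 k) i)) :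
    ∃ n, (xn a1 n : ℤ) ^ 2 = periodForm (a : ℤ) (yn a1 k) i ∧ yn a1 (2 * k) ∣ n ∧ 0 < n := by
  rw [periodForm, four_mul_pellForm_mul_yn_sq] at *
  obtain ⟨n, hn⟩ := (isSquare_pellForm_iff a1).mp h
  rw [abs_of_nonneg (by positivity)] at hn
  refine ⟨n, by rw [xn_sq_eq_pellForm, hn], dvd_of_ysq_dvd a1 ?_, Nat.pos_of_ne_zero ?_⟩
  · exact ⟨i + 1, by zify; linarith⟩
  · rintro rfl
    have := yn_pos a1 (Nat.mul_pos two_pos hk)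
    have hpos : 0 < (yn a1 (2 * k) : ℤ) ^ 2 * (i + 1) := by positivity
    simp [hn] at hpos

theorem exists_isSquare_periodForm {k : ℕ} (hk : 0 < k) :
    ∃ i : ℕ, IsSquare (periodForm (a : ℤ) (yn a1 k) i) := by
  have hy := yn_pos a1 (Nat.mul_pos two_pos hk)
  obtain ⟨e, he⟩ := ysq_dvd_yy a1 (2 * k)
  have he0 : e ≠ 0 := by
    rintro rfl
    exact (yn_pos a1 (Nat.mul_pos (Nat.mul_pos two_pos hk) hy)).ne' he
  obtain ⟨i, rfl⟩ := Nat.exists_eq_succ_of_ne_zero he0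
  refine ⟨i, ?_⟩
  have h := isSquare_pellForm_yn a1 (2 * k * yn a1 (2 * k))
  rw [he] at h
  rw [periodForm, four_mul_pellForm_mul_yn_sq, sq]
  exact_mod_cast h

theorem eq_of_shifted_solution {k n m b : ℕ} {h : ℤ} (hb : 0 < b) (hbk : b ≤ yn a1 k) (hk : 0 < k)
    (hkn : 2 * k ≤ n) (hyn : yn a1 k ∣ n)
    (hga : (g : ℤ) ≡ a [ZMOD xn a1 n]) (hg : (g : ℤ) ≡ 1 [ZMOD 2 * yn a1 k])
    (hhk : h ≡ yn a1 k [ZMOD xn a1 n]) (hhb : h ≡ b [ZMOD 2 * yn a1 k]) (hm : |h| = yn g1 m) :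
    k = b := by
  have hsq : (yn a1 m : ℤ) ^ 2 ≡ yn a1 k ^ 2 [ZMOD xn a1 n] := by
    calc (yn a1 m : ℤ) ^ 2 ≡ yn g1 m ^ 2 [ZMOD xn a1 n] := (yn_modEq_yn a1 g1 hga.symm m).pow 2
      _ = h ^ 2 := by rw [← hm, sq_abs]
      _ ≡ yn a1 k ^ 2 [ZMOD xn a1 n] := hhk.pow 2
  have hmk : (m : ℤ) ≡ k [ZMOD 2 * yn a1 k] ∨ (m : ℤ) ≡ -k [ZMOD 2 * yn a1 k] := by
    have hdvd : (2 * yn a1 k : ℤ) ∣ 2 * n := by exact_mod_cast mul_dvd_mul_left 2 hyn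
    exact (modEq_or_modEq_neg_of_yn_sq_modEq a1 hk hkn hsq).imp (.of_dvd hdvd) (.of_dvd hdvd)
  have hmb : (m : ℤ) ≡ b [ZMOD 2 * yn a1 k] ∨ (m : ℤ) ≡ -b [ZMOD 2 * yn a1 k] := by
    have hmh : (m : ℤ) ≡ |h| [ZMOD 2 * yn a1 k] :=
      hm ▸ ((yn_modEq_index g1 m).of_dvd hg.symm.dvd).symm
    rcases abs_choice h with h0 | h0 <;> rw [h0] at hmh
    · exact .inl (hmh.trans hhb)
    · exact .inr (hmh.trans hhb.neg)
  have hkb : (k : ℤ) ≡ b [ZMOD 2 * yn a1 k] ∨ (k : ℤ) ≡ -b [ZMOD 2 * yn a1 k] := by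
    rcases hmk with hmk | hmk <;> rcases hmb with hmb | hmb
    · exact .inl (hmk.symm.trans hmb)
    · exact .inr (hmk.symm.trans hmb)
    · exact .inr (by simpa using (hmk.symm.trans hmb).neg)
    · exact .inl (by simpa using (hmk.symm.trans hmb).neg)
  have hky := yn_ge_n a1 k
  exact_mod_cast eq_of_modEq_or_modEq_neg (by omega) (by omega) (by omega) (by omega) hkb

theorem eq_yn_of_isSquare_indexForm {b c i j : ℕ} (hb : 0 < b) (hbc : b ≤ c)
    (h : IsSquare (indexForm (a : ℤ) b c i j)) : c = yn a1 b := by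
  have ha : (1 : ℤ) < a := by exact_mod_cast a1
  have hc : (1 : ℤ) ≤ c := by exact_mod_cast hb.trans_le hbc
  have hi : (0 : ℤ) ≤ i := Int.natCast_nonneg i
  obtain ⟨hD, hF, hI⟩ := (isSquare_indexForm_iff ha hc hi).mp h
  have hg := lt_shiftedBase_periodForm ha hc hi
  have hF1 := periodForm_modEq_one_two_mul a c i
  obtain ⟨k, hk⟩ := (isSquare_pellForm_iff a1).mp hD
  obtain rfl : c = yn a1 k := by simpa using hk
  have hk0 : 0 < k := Nat.pos_of_ne_zero <| by rintro rfl; simp at hc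
  obtain ⟨n, hn, hkn, hn0⟩ := exists_index_of_isSquare_periodForm a1 hk0 hF
  have hxF : (xn a1 n : ℤ) ∣ periodForm (a : ℤ) (yn a1 k) i := hn ▸ dvd_pow_self _ two_ne_zero
  have hga := (shiftedBase_modEq (a : ℤ) (periodForm a (yn a1 k) i)).of_dvd hxF
  have hg1 := shiftedBase_modEq_one (a : ℤ) hF1
  obtain ⟨g, hgG⟩ := Int.eq_ofNat_of_zero_le (Int.one_pos.trans (ha.trans hg)).le
  rw [hgG] at hg hga hg1 hI
  have g1 : 1 < g := by omega
  obtain ⟨m, hm⟩ := (isSquare_pellForm_iff g1).mp hI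
  rw [eq_of_shifted_solution a1 g1 hb hbc hk0
    ((yn_ge_n a1 (2 * k)).trans (Nat.le_of_dvd hn0 hkn))
    (((y_dvd_iff a1 _ _).mpr (dvd_mul_left k 2)).trans hkn) hga hg1
    ((shiftedIndex_modEq _ _ _ _).of_dvd hxF) (shiftedIndex_modEq_of_modEq_one _ _ hF1) hm]

theorem exists_isSquare_indexForm {b : ℕ} (hb : 0 < b) :
    ∃ i j : ℕ, IsSquare (indexForm (a : ℤ) b (yn a1 b) i j) := by
  have ha : (1 : ℤ) < a := by exact_mod_cast a1
  have hbc : (b : ℤ) ≤ yn a1 b := by exact_mod_cast yn_ge_n a1 b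
  have hc : (1 : ℤ) ≤ yn a1 b := by omega
  obtain ⟨i, hF⟩ := exists_isSquare_periodForm a1 hb
  have hi : (0 : ℤ) ≤ i := Int.natCast_nonneg i
  have hF0 := add_one_le_periodForm ha hc hi
  have hF1 := periodForm_modEq_one_two_mul a (yn a1 b) i
  have hg := lt_shiftedBase_periodForm ha hc hi
  have hga := shiftedBase_modEq (a : ℤ) (periodForm a (yn a1 b) i)
  have hg1 := shiftedBase_modEq_one (a : ℤ) hF1
  obtain ⟨g, hgG⟩ := Int.eq_ofNat_of_zero_le (Int.one_pos.trans (ha.trans hg)).le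
  rw [hgG] at hg hga hg1
  have g1 : 1 < g := by omega
  obtain ⟨j, hj⟩ := exists_shiftedIndex_eq (by omega) (by linarith) hbc
    (Int.ofNat_le.mpr (yn_le_yn a1 g1 (by omega) b)) hF1
    (yn_modEq_yn g1 a1 hga b) ((yn_modEq_index g1 b).of_dvd hg1.symm.dvd)
  refine ⟨i, j, (isSquare_indexForm_iff ha hc hi).mpr ⟨isSquare_pellForm_yn a1 b, hF, ?_⟩⟩
  rw [hgG, hj]
  exact isSquare_pellForm_yn g1 b

end Solutions

/-- The product of the four conjugates `z ± √a ± (a + 1) * √b`. For positive `a`, `b` the factor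
`a + 1` ensures `z ≠ 0`, so that an integral root `z` forces both `a` and `b` to be squares. -/
def squarePairForm {R : Type*} [CommRing R] (a b z : R) : R :=
  (z ^ 2 - a - (a + 1) ^ 2 * b) ^ 2 - 4 * (a + 1) ^ 2 * (a * b)

theorem map_squarePairForm {R S : Type*} [CommRing R] [CommRing S] (φ : R →+* S) (a b z : R) :
    φ (squarePairForm a b z) = squarePairForm (φ a) (φ b) (φ z) := by
  have h4 : φ 4 = 4 := map_ofNat φ 4
  simp [squarePairForm, h4]

theorem squarePairForm_sq_eq_zero_iff {r t z : ℤ} : squarePairForm (r ^ 2) (t ^ 2) z = 0 ↔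
    |z - r| = |(r ^ 2 + 1) * t| ∨ |z + r| = |(r ^ 2 + 1) * t| := by
  have hfac : squarePairForm (r ^ 2) (t ^ 2) z =
      ((z - r) ^ 2 - ((r ^ 2 + 1) * t) ^ 2) * ((z + r) ^ 2 - ((r ^ 2 + 1) * t) ^ 2) := by
    rw [squarePairForm]
    ring
  rw [hfac, mul_eq_zero, sub_eq_zero, sub_eq_zero, sq_eq_sq_iff_abs_eq_abs,
    sq_eq_sq_iff_abs_eq_abs]

theorem isSquare_of_isSquare_mul {a b : ℤ} (hb0 : b ≠ 0) (hb : IsSquare b)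
    (hab : IsSquare (a * b)) : IsSquare a := by
  obtain ⟨t, rfl⟩ := hb
  obtain ⟨c, hc⟩ := hab
  obtain ⟨r, rfl⟩ : t ∣ c := (Int.pow_dvd_pow_iff two_ne_zero).mp ⟨a, by linarith⟩
  exact ⟨r, mul_right_cancel₀ hb0 (by linarith)⟩

theorem isSquare_of_squarePairForm_eq_zero {a b z : ℤ} (ha : 0 < a) (hb : 0 < b)
    (h : squarePairForm a b z = 0) : IsSquare a ∧ IsSquare b := by
  have hW : (z ^ 2 - a - (a + 1) ^ 2 * b) ^ 2 = (2 * (a + 1)) ^ 2 * (a * b) := by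
    rw [squarePairForm] at h
    linarith
  obtain ⟨c, hc⟩ : 2 * (a + 1) ∣ z ^ 2 - a - (a + 1) ^ 2 * b :=
    (Int.pow_dvd_pow_iff two_ne_zero).mp ⟨a * b, hW⟩
  have hab : a * b = c ^ 2 := by
    refine mul_left_cancel₀ (pow_ne_zero 2 (by linarith : 2 * (a + 1) ≠ 0)) ?_
    rw [← hW, hc, mul_pow]
  have hbz : b * z ^ 2 = (c + (a + 1) * b) ^ 2 := by linear_combination b * hc + hab
  have hz : z ≠ 0 := by
    rintro rfl
    have hcb : c = -((a + 1) * b) := by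
      have : c + (a + 1) * b = 0 := pow_eq_zero_iff two_ne_zero |>.mp (by linarith)
      linarith
    have hab' : a = (a + 1) ^ 2 * b := mul_right_cancel₀ hb.ne' (by rw [hab, hcb]; ring)
    nlinarith
  have hb' : IsSquare b :=
    isSquare_of_isSquare_mul (pow_ne_zero 2 hz) (.sq z) (hbz ▸ .sq _)
  exact ⟨isSquare_of_isSquare_mul hb.ne' hb' (hab ▸ .sq c), hb'⟩

theorem abs_le_of_squarePairForm_eq_zero {a b z : ℤ} (ha : 0 < a) (hb : 0 < b)
    (h : squarePairForm a b z = 0) : |z| ≤ a + (a + 1) * b := by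
  obtain ⟨ha', hb'⟩ := isSquare_of_squarePairForm_eq_zero ha hb h
  obtain ⟨r, rfl⟩ := isSquare_iff_exists_sq _ |>.mp ha'
  obtain ⟨t, rfl⟩ := isSquare_iff_exists_sq _ |>.mp hb'
  have hle (x : ℤ) : |x| ≤ x ^ 2 := Int.natCast_natAbs x ▸ Int.natAbs_le_self_sq x
  have hrt : |(r ^ 2 + 1) * t| ≤ (r ^ 2 + 1) * t ^ 2 := by
    rw [abs_mul, abs_of_pos (by positivity : 0 < r ^ 2 + 1)]
    gcongr
    exact hle t
  rcases squarePairForm_sq_eq_zero_iff.mp h with hz | hz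
  · have := abs_add_le (z - r) r
    rw [sub_add_cancel] at this
    linarith [hle r]
  · have := abs_sub (z + r) r
    rw [add_sub_cancel_right] at this
    linarith [hle r]

theorem exists_squarePairForm_eq_zero {a b : ℤ} (ha : IsSquare a) (hb : IsSquare b) :
    ∃ z : ℕ, squarePairForm a b (z : ℤ) = 0 := by
  obtain ⟨r, rfl⟩ := isSquare_iff_exists_sq _ |>.mp ha
  obtain ⟨t, rfl⟩ := isSquare_iff_exists_sq _ |>.mp hb
  obtain ⟨z, hz⟩ := Int.eq_ofNat_of_zero_le (by positivity : 0 ≤ |r| + (r ^ 2 + 1) * |t|)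
  refine ⟨z, ?_⟩
  rw [← sq_abs r, ← sq_abs t, squarePairForm_sq_eq_zero_iff, ← hz]
  left
  rw [add_sub_cancel_left, sq_abs]

theorem exists_squarePairForm_eq_zero_iff {a b : ℤ} (ha : 0 < a) (hb : 0 < b) :
    (∃ z : ℕ, squarePairForm a b (z : ℤ) = 0) ↔ IsSquare a ∧ IsSquare b :=
  ⟨fun ⟨_, h⟩ => isSquare_of_squarePairForm_eq_zero ha hb h,
    fun h => exists_squarePairForm_eq_zero h.1 h.2⟩

/-- The substitution for the unknown `z` of `squarePairForm` that makes `0 < t` necessary: the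
roots `z` are bounded by `a + (a + 1) * b`, while this is smaller than the negative of that bound
for all `t ≤ 0` and `0 ≤ v`. -/
def signShift {R : Type*} [CommRing R] (a b t v : R) : R :=
  (a + (a + 1) * b + 1) * (2 * t - 1) - v

theorem map_signShift {R S : Type*} [CommRing R] [CommRing S] (φ : R →+* S) (a b t v : R) :
    φ (signShift a b t v) = signShift (φ a) (φ b) (φ t) (φ v) := by
  have h2 : φ 2 = 2 := map_ofNat φ 2
  simp [signShift, h2]

theorem exists_squarePairForm_signShift_eq_zero_iff {a b t : ℤ} (ha : 0 < a) (hb : 0 < b) :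
    (∃ v : ℕ, squarePairForm a b (signShift a b t v) = 0) ↔
      (IsSquare a ∧ IsSquare b) ∧ 0 < t := by
  have : 0 < a + (a + 1) * b + 1 := by positivity
  constructor
  · rintro ⟨v, hv⟩
    refine ⟨isSquare_of_squarePairForm_eq_zero ha hb hv, ?_⟩
    have hlow := (abs_le.mp (abs_le_of_squarePairForm_eq_zero ha hb hv)).1
    by_contra! ht
    have hup : (a + (a + 1) * b + 1) * (2 * t - 1) ≤ (a + (a + 1) * b + 1) * -1 := by
      gcongr
      linarith
    rw [signShift] at hlow
    linarith [Int.natCast_nonneg v]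
  · rintro ⟨⟨ha', hb'⟩, ht⟩
    obtain ⟨z, hz⟩ := exists_squarePairForm_eq_zero ha' hb'
    have hup := (abs_le.mp (abs_le_of_squarePairForm_eq_zero ha hb hz)).2
    have hlow : (a + (a + 1) * b + 1) * 1 ≤ (a + (a + 1) * b + 1) * (2 * t - 1) := by
      gcongr
      linarith
    obtain ⟨v, hv⟩ := Int.eq_ofNat_of_zero_le
      (by linarith : 0 ≤ (a + (a + 1) * b + 1) * (2 * t - 1) - z)
    refine ⟨v, ?_⟩
    rw [signShift, show (a + (a + 1) * b + 1) * (2 * t - 1) - v = (z : ℤ) by linarith, hz]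

theorem eq_sum_mul_pow_div_mod {U : ℕ} {d : ℕ → ℕ} (hd : ∀ i, d i < U) {s n : ℕ} (hsn : s < n) :
    d s = (∑ i ∈ Finset.range n, d i * U ^ i) / U ^ s % U := by
  have hU : 0 < U := (Nat.zero_le _).trans_lt (hd 0)
  induction s generalizing d n with
  | zero =>
    obtain ⟨m, rfl⟩ := Nat.exists_eq_add_of_lt hsn
    simp only [Finset.sum_range_succ', pow_succ, ← mul_assoc, ← Finset.sum_mul]
    simp [Nat.mod_eq_of_lt (hd 0)]
  | succ s ih =>
    obtain ⟨m, rfl⟩ := Nat.exists_eq_add_of_lt hsn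
    rw [ih (fun i => hd (i + 1)) (show s < s + 1 + m by omega), pow_succ',
      ← Nat.div_div_eq_div_mul]
    congr 2
    simp only [Finset.sum_range_succ', pow_succ, ← mul_assoc, ← Finset.sum_mul]
    rw [pow_zero, mul_one, Nat.add_div_of_dvd_right (Dvd.intro_left _ rfl),
      Nat.mul_div_cancel _ hU, Nat.div_eq_of_lt (hd 0), add_zero]

theorem choose_eq_pow_div_mod {n s U : ℕ} (hU : 2 ^ n < U) (hsn : s ≤ n) :
    n.choose s = (U + 1) ^ n / U ^ s % U := by
  have hdigit (i : ℕ) : n.choose i < U := (Nat.choose_le_two_pow n i).trans_lt hU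
  rw [eq_sum_mul_pow_div_mod hdigit (Nat.lt_succ_of_le hsn), add_pow]
  simp [mul_comm]

theorem not_pow_dvd_add_one_pow {U s : ℕ} (hU : 1 < U) (hs : s ≠ 0) (n : ℕ) :
    ¬ U ^ s ∣ (U + 1) ^ n := by
  have hcop : Nat.Coprime (U ^ s) ((U + 1) ^ n) := .pow s n (by simp)
  exact fun h => (Nat.one_lt_pow hs hU).ne' (hcop.eq_one_of_dvd h)

theorem pow_mul_sub_le_pred_pow_mul {x : ℤ} (hx : 1 ≤ x) (n : ℕ) :
    x ^ n * (x - n) ≤ (x - 1) ^ n * x := by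
  induction n with
  | zero => simp
  | succ n ih =>
    calc x ^ (n + 1) * (x - (n + 1 : ℕ)) = x ^ n * (x ^ 2 - (n + 1) * x) := by push_cast; ring
      _ ≤ x ^ n * (x ^ 2 - (n + 1) * x + n) := by gcongr; omega
      _ = x ^ n * (x - n) * (x - 1) := by ring
      _ ≤ (x - 1) ^ n * x * (x - 1) := by gcongr
      _ = (x - 1) ^ (n + 1) * x := by ring

theorem pow_mul_pred_lt_pred_pow_mul {x w : ℤ} (hw : 0 ≤ w) {n : ℕ} (h : n * w < x) :
    x ^ n * (w - 1) < (x - 1) ^ n * w := by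
  have hx : 0 < x := (by positivity : 0 ≤ n * w).trans_lt h
  refine lt_of_mul_lt_mul_right ?_ hx.le
  calc x ^ n * (w - 1) * x = x ^ n * ((w - 1) * x) := by ring
    _ < x ^ n * ((x - n) * w) := mul_lt_mul_of_pos_left (by linarith) (pow_pos hx n)
    _ = x ^ n * (x - n) * w := by ring
    _ ≤ (x - 1) ^ n * x * w := mul_le_mul_of_nonneg_right (pow_mul_sub_le_pred_pow_mul hx n) hw
    _ = (x - 1) ^ n * w * x := by ring

section Quotient

variable {M U p s : ℕ} (hM : 1 < M) (hMU : 1 < M * U) (hMV : 1 < M * (U + 1))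

theorem yn_mul_yn_le :
    (yn hM (p + 1) * yn hMU (s + 1) : ℤ) ≤ (2 * M) ^ (p + s) * U ^ s := by
  calc (yn hM (p + 1) * yn hMU (s + 1) : ℤ) ≤ (2 * M) ^ p * (2 * (M * U)) ^ s := by
        exact_mod_cast Nat.mul_le_mul (yn_succ_le_pow hM p) (yn_succ_le_pow hMU s)
    _ = (2 * M) ^ (p + s) * U ^ s := by ring

theorem le_yn_mul_yn :
    (2 * M - 1 : ℤ) ^ (p + s) * U ^ s ≤ yn hM (p + 1) * yn hMU (s + 1) := by
  have hU : (1 : ℤ) ≤ U := by exact_mod_cast Nat.pos_of_mul_pos_left (Nat.zero_lt_of_lt hMU)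
  have hM0 : (0 : ℤ) ≤ 2 * M - 1 := by omega
  calc (2 * M - 1 : ℤ) ^ (p + s) * U ^ s = (2 * M - 1) ^ p * ((2 * M - 1) * U) ^ s := by
        rw [mul_pow, pow_add, mul_assoc]
    _ ≤ (2 * M - 1) ^ p * (2 * (M * U : ℕ) - 1) ^ s := by
      gcongr
      push_cast
      linarith
    _ ≤ yn hM (p + 1) * yn hMU (s + 1) :=
      mul_le_mul (pow_le_yn_succ hM p) (pow_le_yn_succ hMU s) (pow_nonneg (by omega) s)
        (Int.natCast_nonneg _)

theorem yn_mul_yn_mul_lt {n q : ℕ} (hn : p + s = n) (hnM : n * (U + 1) ^ n < M)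
    (hq : U ^ s * q < (U + 1) ^ n) :
    yn hM (p + 1) * yn hMU (s + 1) * q < yn hMV (n + 1) := by
  have hle := yn_mul_yn_le (p := p) (s := s) hM hMU
  rw [hn] at hle
  have hpow : (2 * M * (U + 1) : ℤ) ^ n * ((U + 1) ^ n - 1) <
      (2 * M * (U + 1) - 1) ^ n * (U + 1) ^ n := by
    refine pow_mul_pred_lt_pred_pow_mul (by positivity) ?_
    zify at hnM
    linarith [(by positivity : (0 : ℤ) ≤ M * U)]
  have hlow := pow_le_yn_succ hMV n
  push_cast [← mul_assoc] at hlow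
  zify at hq ⊢
  calc (yn hM (p + 1) * yn hMU (s + 1) * q : ℤ) ≤ (2 * M) ^ n * U ^ s * q := by gcongr
    _ = (2 * M) ^ n * (U ^ s * q) := by ring
    _ ≤ (2 * M) ^ n * ((U + 1) ^ n - 1) := by gcongr; omega
    _ < (2 * M * (U + 1) - 1) ^ n := by
      refine lt_of_mul_lt_mul_right (a := (U + 1 : ℤ) ^ n) ?_ (by positivity)
      calc (2 * M : ℤ) ^ n * ((U + 1) ^ n - 1) * (U + 1) ^ n
          = (2 * M * (U + 1)) ^ n * ((U + 1) ^ n - 1) := by rw [mul_pow _ (U + 1 : ℤ)]; ring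
        _ < (2 * M * (U + 1) - 1) ^ n * (U + 1) ^ n := hpow
    _ ≤ yn hMV (n + 1) := hlow

theorem lt_yn_mul_yn_mul {n q : ℕ} (hn : p + s = n) (hnM : n * (U + 1) ^ n < M)
    (hq : (U + 1) ^ n < U ^ s * q) :
    yn hMV (n + 1) < yn hM (p + 1) * yn hMU (s + 1) * q := by
  have hle := le_yn_mul_yn (p := p) (s := s) hM hMU
  rw [hn] at hle
  have hpow : (2 * M : ℤ) ^ n * ((U + 1) ^ n + 1 - 1) < (2 * M - 1) ^ n * ((U + 1) ^ n + 1) := by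
    refine pow_mul_pred_lt_pred_pow_mul (by positivity) ?_
    have hnV : (n : ℤ) * 1 ≤ n * (U + 1) ^ n := by
      gcongr
      exact one_le_pow₀ (by omega)
    zify at hnM
    linarith
  have hM0 : (0 : ℤ) ≤ 2 * M - 1 := by omega
  have hup := yn_succ_le_pow hMV n
  rw [← mul_assoc, mul_pow] at hup
  zify at hq hup ⊢
  calc (yn hMV (n + 1) : ℤ) ≤ (2 * M) ^ n * (U + 1) ^ n := hup
    _ = (2 * M) ^ n * ((U + 1) ^ n + 1 - 1) := by ring
    _ < (2 * M - 1) ^ n * ((U + 1) ^ n + 1) := hpow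
    _ ≤ (2 * M - 1) ^ n * (U ^ s * q) := by gcongr; exact hq
    _ = (2 * M - 1) ^ n * U ^ s * q := by ring
    _ ≤ yn hM (p + 1) * yn hMU (s + 1) * q := by gcongr

theorem yn_quotient_eq_iff {n Q : ℕ} (hn : p + s = n) (hnM : n * (U + 1) ^ n < M)
    (hdvd : ¬ U ^ s ∣ (U + 1) ^ n) :
    (yn hM (p + 1) * yn hMU (s + 1) * Q < yn hMV (n + 1) ∧
      yn hMV (n + 1) < yn hM (p + 1) * yn hMU (s + 1) * (Q + 1)) ↔
    (U + 1) ^ n / U ^ s = Q := by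
  have hne (t : ℕ) : U ^ s * t ≠ (U + 1) ^ n := fun h => hdvd ⟨t, h.symm⟩
  have hlt (t : ℕ) : yn hM (p + 1) * yn hMU (s + 1) * t < yn hMV (n + 1) ↔
      U ^ s * t < (U + 1) ^ n :=
    ⟨fun h => lt_of_not_ge fun h' =>
      h.asymm (lt_yn_mul_yn_mul hM hMU hMV hn hnM (h'.lt_of_ne (hne t).symm)),
      yn_mul_yn_mul_lt hM hMU hMV hn hnM⟩
  have hgt (t : ℕ) : yn hMV (n + 1) < yn hM (p + 1) * yn hMU (s + 1) * t ↔
      (U + 1) ^ n < U ^ s * t :=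
    ⟨fun h => lt_of_not_ge fun h' =>
      h.asymm (yn_mul_yn_mul_lt hM hMU hMV hn hnM (h'.lt_of_ne (hne t))),
      lt_yn_mul_yn_mul hM hMU hMV hn hnM⟩
  have hU : 0 < U := Nat.pos_of_mul_pos_left (Nat.zero_lt_of_lt hMU)
  rw [hlt, hgt, Nat.div_eq_iff (pow_pos hU s), mul_comm Q, mul_add_one]
  have := hne Q
  omega

end Quotient

theorem eq_yn_of_isSquare_pellForm {a b t : ℕ} (a1 : 1 < a) (hb : 0 < b) (hba : b < a - 1)
    (h : IsSquare (pellForm (a : ℤ) t)) (htb : t ≡ b [MOD a - 1]) (hta : t < a ^ (a - 1)) :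
    t = yn a1 b := by
  obtain ⟨k, hk⟩ := (isSquare_pellForm_iff a1).mp h
  obtain rfl : t = yn a1 k := by simpa using hk
  rcases k with _ | k
  · rw [yn_zero] at htb
    rw [← Nat.eq_zero_of_dvd_of_lt ((Nat.modEq_zero_iff_dvd).mp htb.symm) hba]
  have hka : k < a - 1 :=
    (Nat.pow_lt_pow_iff_right a1).mp ((base_pow_le_yn_succ a1 k).trans_lt hta)
  have hkb : k + 1 ≡ b [MOD a - 1] := (yn_modEq_a_sub_one a1 (k + 1)).symm.trans htb
  have hdvd := (Nat.modEq_iff_dvd.mp hkb)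
  have := Int.eq_zero_of_abs_lt_dvd hdvd (by rw [abs_lt]; omega)
  rw [show k + 1 = b by omega]

theorem exists_add_mul_eq_yn {a : ℕ} (a1 : 1 < a) (b : ℕ) : ∃ k, b + k * (a - 1) = yn a1 b := by
  obtain ⟨k, hk⟩ := (Nat.modEq_iff_dvd' (yn_ge_n a1 b)).mp (yn_modEq_a_sub_one a1 b).symm
  refine ⟨k, ?_⟩
  rw [mul_comm, ← hk, Nat.add_sub_cancel' (yn_ge_n a1 b)]

section Growth

variable {R S : Type*} [CommSemiring R] [CommSemiring S]

/-- `pellForm (b + 1) (b * (w + 1))`, written without subtraction so that it makes sense in `ℕ`.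
It is a square only for `w` so large that `(b + 1) ^ (b - 1) ≤ b * (w + 1)`. -/
def growthForm (b w : R) : R := b * (b + 2) * (b * (w + 1)) ^ 2 + 1

theorem map_growthForm (φ : R →+* S) (b w : R) : φ (growthForm b w) = growthForm (φ b) (φ w) := by
  have h2 : φ 2 = 2 := map_ofNat φ 2
  simp [growthForm, h2]

/-- The base `U` whose digits are read off; it exceeds `2 ^ n` if the growth form of `n + 2` and `w`
is a square. -/
def smallBase (y n w : R) : R := (n + 2) * (w + 1) * (y + 1)

/-- The number `b` from which the Pell base `M` is built. Being a multiple of the first growth form,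
it makes the two growth forms coprime. -/
def largeFactor (y n w : R) : R := growthForm (n + 2) w * (smallBase y n w + n + 5)

/-- The Pell base `M`; it is at least `(U + n + 6) ^ (n + 2)` if the growth form of `largeFactor`
and `v` is a square. -/
def largeBase (y n w v : R) : R := largeFactor y n w * (v + 1)

/-- The product of two coprime growth forms, which is a square if and only if both of them are. It
ensures that `U` and `M` are large. -/
def basesSquare (y n w v : R) : R := growthForm (n + 2) w * growthForm (largeFactor y n w) v

theorem map_smallBase (φ : R →+* S) (y n w : R) :
    φ (smallBase y n w) = smallBase (φ y) (φ n) (φ w) := by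
  have h2 : φ 2 = 2 := map_ofNat φ 2
  simp [smallBase, h2]

theorem map_largeFactor (φ : R →+* S) (y n w : R) :
    φ (largeFactor y n w) = largeFactor (φ y) (φ n) (φ w) := by
  have h2 : φ 2 = 2 := map_ofNat φ 2
  have h5 : φ 5 = 5 := map_ofNat φ 5
  simp [largeFactor, map_smallBase, map_growthForm, h2, h5]

theorem map_largeBase (φ : R →+* S) (y n w v : R) :
    φ (largeBase y n w v) = largeBase (φ y) (φ n) (φ w) (φ v) := by
  simp [largeBase, map_largeFactor]

theorem map_basesSquare (φ : R →+* S) (y n w v : R) :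
    φ (basesSquare y n w v) = basesSquare (φ y) (φ n) (φ w) (φ v) := by
  have h2 : φ 2 = 2 := map_ofNat φ 2
  simp [basesSquare, map_growthForm, map_largeFactor, h2]

end Growth

theorem isSquare_growthForm_iff {b w : ℕ} :
    IsSquare (growthForm b w) ↔ IsSquare (pellForm ((b + 1 : ℕ) : ℤ) ((b * (w + 1) : ℕ) : ℤ)) := by
  have h : ((growthForm b w : ℕ) : ℤ) =
      pellForm ((b + 1 : ℕ) : ℤ) ((b * (w + 1) : ℕ) : ℤ) := by
    rw [growthForm, pellForm]
    push_cast
    ring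
  rw [← h, Int.isSquare_natCast_iff]

theorem exists_isSquare_growthForm {b : ℕ} (hb : 0 < b) : ∃ w, IsSquare (growthForm b w) := by
  have a1 : 1 < b + 1 := by omega
  obtain ⟨k, hk⟩ : b ∣ yn a1 b :=
    Nat.modEq_zero_iff_dvd.mp <| (yn_modEq_a_sub_one a1 b).trans <| by simp [Nat.ModEq]
  obtain ⟨w, rfl⟩ := Nat.exists_eq_succ_of_ne_zero
    (show k ≠ 0 by rintro rfl; exact (yn_pos a1 hb).ne' hk)
  exact ⟨w, isSquare_growthForm_iff.mpr (hk ▸ isSquare_pellForm_yn a1 b)⟩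

theorem pow_pred_le_of_isSquare_growthForm {b w : ℕ} (hb : 0 < b) (h : IsSquare (growthForm b w)) :
    (b + 1) ^ (b - 1) ≤ b * (w + 1) := by
  have a1 : 1 < b + 1 := by omega
  obtain ⟨k, hk⟩ := (isSquare_pellForm_iff a1).mp (isSquare_growthForm_iff.mp h)
  rw [Nat.abs_cast, Nat.cast_inj] at hk
  have hk0 : k ≠ 0 := by
    rintro rfl
    simp [hb.ne'] at hk
  have hbk : b ∣ k := Nat.modEq_zero_iff_dvd.mp <|
    (yn_modEq_a_sub_one a1 k).symm.trans <| Nat.modEq_zero_iff_dvd.mpr ⟨w + 1, hk.symm⟩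
  have hle := Nat.le_of_dvd (Nat.pos_of_ne_zero hk0) hbk
  calc (b + 1) ^ (b - 1) ≤ (b + 1) ^ (k - 1) := Nat.pow_le_pow_right (by omega) (by omega)
    _ ≤ yn a1 (k - 1 + 1) := base_pow_le_yn_succ a1 (k - 1)
    _ = b * (w + 1) := by rw [hk, Nat.sub_add_cancel (Nat.pos_of_ne_zero hk0)]

theorem growthForm_pos (b w : ℕ) : 0 < growthForm b w := Nat.succ_pos _

theorem smallBase_add_le_largeFactor (y n w : ℕ) :
    smallBase y n w + n + 5 ≤ largeFactor y n w :=
  Nat.le_mul_of_pos_left _ (growthForm_pos _ _)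

theorem basesSquare_pos (y n w v : ℕ) : 0 < basesSquare y n w v :=
  Nat.mul_pos (growthForm_pos _ _) (growthForm_pos _ _)

theorem isSquare_basesSquare_iff {y n w v : ℕ} : IsSquare (basesSquare y n w v) ↔
    IsSquare (growthForm (n + 2) w) ∧ IsSquare (growthForm (largeFactor y n w) v) := by
  have hdvd : growthForm (n + 2) w ∣ largeFactor y n w * (largeFactor y n w + 2) *
      (largeFactor y n w * (v + 1)) ^ 2 :=
    (Dvd.intro _ rfl : growthForm (n + 2) w ∣ largeFactor y n w).mul_right _ |>.mul_right _
  have hcop : Nat.Coprime (growthForm (n + 2) w) (growthForm (largeFactor y n w) v) :=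
    Nat.Coprime.coprime_dvd_left hdvd (by simp [growthForm])
  simp_rw [← Int.isSquare_natCast_iff, basesSquare, Nat.cast_mul]
  exact isSquare_mul_iff_of_isCoprime (by exact_mod_cast growthForm_pos _ _)
    (by exact_mod_cast growthForm_pos _ _) (Nat.isCoprime_iff_coprime.mpr hcop)

theorem exists_isSquare_basesSquare (y n : ℕ) : ∃ w v, IsSquare (basesSquare y n w v) := by
  obtain ⟨w, hw⟩ := exists_isSquare_growthForm (b := n + 2) (by omega)
  have hle := smallBase_add_le_largeFactor y n w
  obtain ⟨v, hv⟩ := exists_isSquare_growthForm (b := largeFactor y n w) (by omega)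
  exact ⟨w, v, isSquare_basesSquare_iff.mpr ⟨hw, hv⟩⟩

theorem lt_smallBase (y n w : ℕ) : y < smallBase y n w := by
  have : 0 < (n + 2) * (w + 1) := by positivity
  rw [smallBase]
  nlinarith

theorem one_lt_largeBase (y n w v : ℕ) : 1 < largeBase y n w v := by
  have := smallBase_add_le_largeFactor y n w
  exact (by omega : 1 < largeFactor y n w).trans_le (Nat.le_mul_of_pos_right _ v.succ_pos)

theorem two_pow_lt_smallBase {y n w v : ℕ} (h : IsSquare (basesSquare y n w v)) :
    2 ^ n < smallBase y n w := by
  have hgrowth := pow_pred_le_of_isSquare_growthForm (by omega) (isSquare_basesSquare_iff.mp h).1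
  calc 2 ^ n < 2 ^ (n + 1) := Nat.pow_lt_pow_right one_lt_two n.lt_succ_self
    _ ≤ (n + 2 + 1) ^ (n + 1) := Nat.pow_le_pow_left (by omega) _
    _ ≤ (n + 2) * (w + 1) := hgrowth
    _ ≤ smallBase y n w := Nat.le_mul_of_pos_right _ y.succ_pos

theorem pow_le_largeBase {y n w v : ℕ} (h : IsSquare (basesSquare y n w v)) :
    (smallBase y n w + n + 6) ^ (n + 2) ≤ largeBase y n w v := by
  have hle := smallBase_add_le_largeFactor y n w
  have hgrowth := pow_pred_le_of_isSquare_growthForm (by omega) (isSquare_basesSquare_iff.mp h).2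
  calc (smallBase y n w + n + 6) ^ (n + 2) ≤ (largeFactor y n w + 1) ^ (n + 2) :=
        Nat.pow_le_pow_left (by omega) _
    _ ≤ (largeFactor y n w + 1) ^ (largeFactor y n w - 1) :=
        Nat.pow_le_pow_right (by omega) (by omega)
    _ ≤ largeBase y n w v := hgrowth

section ChooseForm

variable {R S : Type*} [CommRing R] [CommRing S]

/-- Positive if and only if `d * q < c < d * (q + 1)` and `0 < y`. The factor `y` excludes the
quotient `q = 0`, for which the inequalities would not bound the divisor `d`. -/
def gapForm (y c d q : R) : R := y * ((c - d * q) * (d * (q + 1) - c))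

/-- This vanishes for some `v₁` and `v₂` if and only if `A`, the index form for `M (U + 1)`, and the
Pell forms for `M` and `M U` are squares and moreover `0 < y` and `q < c / (e * f) < q + 1`. -/
def ratioForm (y n U M A q c e f i j v₁ v₂ : R) : R :=
  squarePairForm (indexForm (M * (U + 1)) (n + 1) c i j) A
      (signShift (indexForm (M * (U + 1)) (n + 1) c i j) A (gapForm y c (e * f) q) v₁) ^ 2 +
    squarePairForm (pellForm M e) (pellForm (M * U) f) v₂ ^ 2

/-- The Diophantine representation of `y = n.choose s`, where `s ≤ n`. The residues of the two Pell
solutions in the denominator are built into their parametrizations by `k` and `l`. -/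
def chooseForm (y n s x w k l m i j v₁ v₂ v₃ : R) : R :=
  ratioForm y n (smallBase y n w) (largeBase y n w v₃) (basesSquare y n w v₃)
    (y + x * smallBase y n w) (n + 1 + m) (n - s + 1 + k * (largeBase y n w v₃ - 1))
    (s + 1 + l * (largeBase y n w v₃ * smallBase y n w - 1)) i j v₁ v₂

theorem map_ratioForm (φ : R →+* S) (y n U M A q c e f i j v₁ v₂ : R) :
    φ (ratioForm y n U M A q c e f i j v₁ v₂) =
      ratioForm (φ y) (φ n) (φ U) (φ M) (φ A) (φ q) (φ c) (φ e) (φ f) (φ i) (φ j)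
        (φ v₁) (φ v₂) := by
  simp [ratioForm, gapForm, map_squarePairForm, map_signShift, map_indexForm, map_pellForm]

theorem map_chooseForm (φ : R →+* S) (y n s x w k l m i j v₁ v₂ v₃ : R) :
    φ (chooseForm y n s x w k l m i j v₁ v₂ v₃) =
      chooseForm (φ y) (φ n) (φ s) (φ x) (φ w) (φ k) (φ l) (φ m) (φ i) (φ j)
        (φ v₁) (φ v₂) (φ v₃) := by
  simp [chooseForm, map_ratioForm, map_smallBase, map_largeBase, map_basesSquare]

end ChooseForm

theorem gapForm_pos_iff {y c d q : ℕ} (hd : 0 < d) :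
    0 < gapForm (y : ℤ) c d q ↔ 0 < y ∧ d * q < c ∧ c < d * (q + 1) := by
  unfold gapForm
  zify at hd ⊢
  constructor
  · intro h
    have hy : (0 : ℤ) < y := by
      refine (Int.natCast_nonneg y).lt_of_ne fun hy => ?_
      simp [← hy] at h
    rcases mul_pos_iff.mp ((mul_pos_iff_of_pos_left hy).mp h) with h | h
    · exact ⟨hy, by linarith, by linarith⟩
    · linarith
  · rintro ⟨hy, hlow, hup⟩
    exact mul_pos hy (mul_pos (by linarith) (by linarith))

/-- `c`, `e` and `f` belong to solutions of the Pell equations of bases `M (U + 1)`, `M` and `M U`,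
the first of which has index `n + 1`, and `c / (e * f)` lies strictly between `q` and `q + 1`. -/
structure IsRatioSolution (n U M q c e f i j : ℕ) : Prop where
  isSquare_indexForm : IsSquare (indexForm ((M * (U + 1) : ℕ) : ℤ) (n + 1 : ℕ) c i j)
  isSquare_left : IsSquare (pellForm (M : ℤ) e)
  isSquare_right : IsSquare (pellForm ((M * U : ℕ) : ℤ) f)
  lower : e * f * q < c
  upper : c < e * f * (q + 1)

theorem exists_ratioForm_eq_zero_iff {y n U M A q c e f i j : ℕ} (hU : 0 < U) (hM : 1 < M)
    (hA : 0 < A) (hc : 0 < c) (he : 0 < e) (hf : 0 < f) :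
    (∃ v₁ v₂ : ℕ, ratioForm (y : ℤ) n U M A q c e f i j v₁ v₂ = 0) ↔
      IsSquare A ∧ 0 < y ∧ IsRatioSolution n U M q c e f i j := by
  have hMU : (1 : ℤ) ≤ M * U := by exact_mod_cast Nat.mul_pos (by omega) hU
  have hMV : (1 : ℤ) < M * (U + 1) := by
    exact_mod_cast hM.trans_le (Nat.le_mul_of_pos_right M U.succ_pos)
  have hindex : 0 < indexForm (M * (U + 1) : ℤ) (n + 1) c i j :=
    indexForm_pos hMV (by omega) (by omega)
  have hgap := gapForm_pos_iff (y := y) (c := c) (q := q) (Nat.mul_pos he hf)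
  have hfirst := exists_squarePairForm_signShift_eq_zero_iff (b := A)
    (t := gapForm y c (e * f) q) hindex (by exact_mod_cast hA)
  have hsecond := exists_squarePairForm_eq_zero_iff
    (pellForm_pos (a := (M : ℤ)) (by omega) e) (pellForm_pos hMU f)
  push_cast at hgap
  rw [hgap, Int.isSquare_natCast_iff] at hfirst
  calc (∃ v₁ v₂ : ℕ, ratioForm (y : ℤ) n U M A q c e f i j v₁ v₂ = 0) ↔ _ ∧ _ := by
        simp only [ratioForm, add_eq_zero_iff_of_nonneg (sq_nonneg (_ : ℤ)) (sq_nonneg (_ : ℤ)),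
          pow_eq_zero_iff two_ne_zero, exists_and_left, exists_and_right]
        exact and_congr hfirst hsecond
    _ ↔ _ := by
        constructor
        · rintro ⟨⟨⟨hI, hA⟩, hy, hlow, hup⟩, hK, hL⟩
          exact ⟨hA, hy, by exact_mod_cast hI, hK, by exact_mod_cast hL, hlow, hup⟩
        · rintro ⟨hA, hy, hI, hK, hL, hlow, hup⟩
          exact ⟨⟨⟨by exact_mod_cast hI, hA⟩, hy, hlow, hup⟩, hK, by exact_mod_cast hL⟩

theorem bounds_of_pow_le {n U M : ℕ} (hn : 0 < n) (hM : (U + n + 6) ^ (n + 2) ≤ M) :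
    n * (U + 1) ^ n < M ∧ U + 1 ≤ M ∧ 3 * n + 6 ≤ M := by
  have hbase : (U + n + 6) * (U + n + 6) ≤ (U + n + 6) ^ (n + 2) := by
    rw [pow_add, sq]
    exact Nat.le_mul_of_pos_left _ (by positivity)
  refine ⟨?_, by nlinarith, by nlinarith⟩
  calc n * (U + 1) ^ n < (U + n + 6) * (U + n + 6) ^ n := by gcongr <;> omega
    _ = (U + n + 6) ^ (n + 1) := (pow_succ' _ _).symm
    _ ≤ (U + n + 6) ^ (n + 2) := Nat.pow_le_pow_right (by omega) (by omega)
    _ ≤ M := hM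

theorem yn_lt_pow_pred {n U M : ℕ} (hn : 0 < n) (hM : (U + n + 6) ^ (n + 2) ≤ M)
    (hMV : 1 < M * (U + 1)) : yn hMV (n + 1) < M ^ (M - 1) := by
  obtain ⟨-, hUM, hnM⟩ := bounds_of_pow_le hn hM
  calc yn hMV (n + 1) ≤ (2 * (M * (U + 1))) ^ n := yn_succ_le_pow hMV n
    _ ≤ (M * (M * M)) ^ n :=
      Nat.pow_le_pow_left (Nat.mul_le_mul (by omega) (Nat.mul_le_mul_left M hUM)) n
    _ = M ^ (3 * n) := by rw [pow_mul]; ring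
    _ < M ^ (M - 1) := Nat.pow_lt_pow_right (by omega) (by omega)

namespace IsRatioSolution

variable {p s n U M q c e f i j : ℕ}

theorem eq_yn (h : IsRatioSolution n U M q c e f i j) (hn : p + s = n) (hs : 0 < s) (hU : 0 < U)
    (hM : (U + n + 6) ^ (n + 2) ≤ M) (hq : 0 < q) (hc : n + 1 ≤ c) (he : e ≡ p + 1 [MOD M - 1])
    (hf : f ≡ s + 1 [MOD M * U - 1]) (hM1 : 1 < M) (hMU : 1 < M * U) (hMV : 1 < M * (U + 1)) :
    c = yn hMV (n + 1) ∧ e = yn hM1 (p + 1) ∧ f = yn hMU (s + 1) := by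
  obtain ⟨-, -, hnM⟩ := bounds_of_pow_le (by omega) hM
  have hef : 0 < e * f := Nat.pos_of_mul_pos_right (Nat.zero_lt_of_lt h.upper)
  have he0 : 0 < e := Nat.pos_of_mul_pos_right hef
  have hf0 : 0 < f := Nat.pos_of_mul_pos_left hef
  have hcyn : c = yn hMV (n + 1) :=
    eq_yn_of_isSquare_indexForm hMV n.succ_pos hc h.isSquare_indexForm
  have hcM : c < M ^ (M - 1) := hcyn ▸ yn_lt_pow_pred (by omega) hM hMV
  have heM : e < M ^ (M - 1) := ((Nat.le_mul_of_pos_right e hf0).trans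
    (Nat.le_mul_of_pos_right _ hq)).trans_lt (h.lower.trans hcM)
  have hfM : f < M ^ (M - 1) := ((Nat.le_mul_of_pos_left f he0).trans
    (Nat.le_mul_of_pos_right _ hq)).trans_lt (h.lower.trans hcM)
  have hMMU : M ≤ M * U := Nat.le_mul_of_pos_right M hU
  have hpow : M ^ (M - 1) ≤ (M * U) ^ (M * U - 1) :=
    (Nat.pow_le_pow_left hMMU _).trans (Nat.pow_le_pow_right (by omega) (by omega))
  exact ⟨hcyn,
    eq_yn_of_isSquare_pellForm hM1 p.succ_pos (by omega) h.isSquare_left he heM,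
    eq_yn_of_isSquare_pellForm hMU s.succ_pos (by omega) h.isSquare_right hf (hfM.trans_le hpow)⟩

theorem pow_div_pow_eq (h : IsRatioSolution n U M q c e f i j) (hn : p + s = n) (hs : 0 < s)
    (hU : 1 < U) (hM : (U + n + 6) ^ (n + 2) ≤ M) (hq : 0 < q) (hc : n + 1 ≤ c)
    (he : e ≡ p + 1 [MOD M - 1]) (hf : f ≡ s + 1 [MOD M * U - 1]) :
    (U + 1) ^ n / U ^ s = q := by
  obtain ⟨hnM, -, hM6⟩ := bounds_of_pow_le (by omega) hM
  have hM1 : 1 < M := by omega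
  have hMU : 1 < M * U := hM1.trans_le (Nat.le_mul_of_pos_right M (by omega))
  have hMV : 1 < M * (U + 1) := hM1.trans_le (Nat.le_mul_of_pos_right M U.succ_pos)
  obtain ⟨rfl, rfl, rfl⟩ := h.eq_yn hn hs (by omega) hM hq hc he hf hM1 hMU hMV
  exact (yn_quotient_eq_iff hM1 hMU hMV hn hnM (not_pow_dvd_add_one_pow hU hs.ne' n)).mp
    ⟨h.lower, h.upper⟩

end IsRatioSolution

theorem exists_isRatioSolution {p s n U M : ℕ} (hn : p + s = n) (hs : 0 < s) (hU : 1 < U)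
    (hM : (U + n + 6) ^ (n + 2) ≤ M) :
    ∃ k l m i j : ℕ, IsRatioSolution n U M ((U + 1) ^ n / U ^ s) (n + 1 + m)
      (p + 1 + k * (M - 1)) (s + 1 + l * (M * U - 1)) i j := by
  obtain ⟨hnM, -, hM6⟩ := bounds_of_pow_le (by omega) hM
  have hM1 : 1 < M := by omega
  have hMU : 1 < M * U := hM1.trans_le (Nat.le_mul_of_pos_right M (by omega))
  have hMV : 1 < M * (U + 1) := hM1.trans_le (Nat.le_mul_of_pos_right M U.succ_pos)
  obtain ⟨k, hk⟩ := exists_add_mul_eq_yn hM1 (p + 1)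
  obtain ⟨l, hl⟩ := exists_add_mul_eq_yn hMU (s + 1)
  obtain ⟨m, hm⟩ := Nat.exists_eq_add_of_le (yn_ge_n hMV (n + 1))
  obtain ⟨i, j, hij⟩ := exists_isSquare_indexForm hMV n.succ_pos
  obtain ⟨hlow, hup⟩ := (yn_quotient_eq_iff hM1 hMU hMV hn hnM
    (not_pow_dvd_add_one_pow hU hs.ne' n)).mpr rfl
  refine ⟨k, l, m, i, j, ?_⟩
  rw [hk, hl, ← hm]
  exact ⟨hij, isSquare_pellForm_yn hM1 _, isSquare_pellForm_yn hMU _, hlow, hup⟩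

theorem chooseForm_natCast {y n s p x w k l m i j v₃ : ℕ} (hn : p + s = n) (v₁ v₂ : ℤ) :
    chooseForm (y : ℤ) n s x w k l m i j v₁ v₂ v₃ =
      ratioForm (y : ℤ) n (smallBase y n w : ℕ) (largeBase y n w v₃ : ℕ)
        (basesSquare y n w v₃ : ℕ) (y + x * smallBase y n w : ℕ) (n + 1 + m : ℕ)
        (p + 1 + k * (largeBase y n w v₃ - 1) : ℕ)
        (s + 1 + l * (largeBase y n w v₃ * smallBase y n w - 1) : ℕ) i j v₁ v₂ := by
  have hU : 0 < smallBase y n w := (Nat.zero_le y).trans_lt (lt_smallBase y n w)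
  have hM := one_lt_largeBase y n w v₃
  have hp : (p : ℤ) = n - s := by omega
  have hsmall : ((smallBase y n w : ℕ) : ℤ) = smallBase (y : ℤ) n w :=
    map_smallBase (Nat.castRingHom ℤ) y n w
  have hlarge : ((largeBase y n w v₃ : ℕ) : ℤ) = largeBase (y : ℤ) n w v₃ :=
    map_largeBase (Nat.castRingHom ℤ) y n w v₃
  have hbases : ((basesSquare y n w v₃ : ℕ) : ℤ) = basesSquare (y : ℤ) n w v₃ :=
    map_basesSquare (Nat.castRingHom ℤ) y n w v₃
  have hM0 := Nat.zero_lt_of_lt hM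
  push_cast [Nat.cast_pred hM0, Nat.cast_pred (Nat.mul_pos hM0 hU)]
  rw [hsmall, hlarge, hbases, hp, chooseForm]

theorem exists_chooseForm_eq_zero_iff {y n s p x w k l m i j v₃ : ℕ} (hn : p + s = n) :
    (∃ v₁ v₂ : ℕ, chooseForm (y : ℤ) n s x w k l m i j v₁ v₂ v₃ = 0) ↔
      IsSquare (basesSquare y n w v₃) ∧ 0 < y ∧
        IsRatioSolution n (smallBase y n w) (largeBase y n w v₃) (y + x * smallBase y n w)
          (n + 1 + m) (p + 1 + k * (largeBase y n w v₃ - 1))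
          (s + 1 + l * (largeBase y n w v₃ * smallBase y n w - 1)) i j := by
  simp only [chooseForm_natCast hn]
  exact exists_ratioForm_eq_zero_iff ((Nat.zero_le y).trans_lt (lt_smallBase y n w))
    (one_lt_largeBase y n w v₃) (basesSquare_pos y n w v₃) (by omega) (by omega) (by omega)

theorem eq_choose_iff_exists_chooseForm_eq_zero {y n s : ℕ} (hs : 0 < s) (hsn : s ≤ n) :
    y = n.choose s ↔ ∃ x w k l m i j v₁ v₂ v₃ : ℕ,
      chooseForm (y : ℤ) n s x w k l m i j v₁ v₂ v₃ = 0 := by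
  have hn : n - s + s = n := Nat.sub_add_cancel hsn
  constructor
  · rintro rfl
    obtain ⟨w, v₃, hA⟩ := exists_isSquare_basesSquare (n.choose s) n
    have hU := two_pow_lt_smallBase hA
    obtain ⟨k, l, m, i, j, h⟩ := exists_isRatioSolution hn hs (Nat.one_le_two_pow.trans_lt hU)
      (pow_le_largeBase hA)
    rw [← Nat.mod_add_div' ((_ + 1) ^ n / _), ← choose_eq_pow_div_mod hU hsn] at h
    obtain ⟨v₁, v₂, h⟩ := (exists_chooseForm_eq_zero_iff hn).mpr ⟨hA, Nat.choose_pos hsn, h⟩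
    exact ⟨_, w, k, l, m, i, j, v₁, v₂, v₃, h⟩
  · rintro ⟨x, w, k, l, m, i, j, v₁, v₂, v₃, h⟩
    obtain ⟨hA, hy, h⟩ := (exists_chooseForm_eq_zero_iff hn).mp ⟨v₁, v₂, h⟩
    have hU := two_pow_lt_smallBase hA
    have hq := h.pow_div_pow_eq hn hs (Nat.one_le_two_pow.trans_lt hU) (pow_le_largeBase hA)
      (by omega) (by omega) (by simp [Nat.ModEq]) (by simp [Nat.ModEq])
    rw [choose_eq_pow_div_mod hU hsn, hq, Nat.add_mul_mod_self_right,
      Nat.mod_eq_of_lt (lt_smallBase y n w)]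

theorem theorem2p3 :
    ∃ F : MvPolynomial (Fin 13) ℤ,
      ∀ y n s : ℕ, 0 < s → s ≤ n →
        (y = n.choose s ↔
          ∃ x w k l m i j v₁ v₂ v₃ : ℕ,
            MvPolynomial.eval
              (![(y : ℤ), (n : ℤ), (s : ℤ), (x : ℤ), (w : ℤ), (k : ℤ), (l : ℤ), (m : ℤ),
                (i : ℤ), (j : ℤ), (v₁ : ℤ), (v₂ : ℤ), (v₃ : ℤ)] : Fin 13 → ℤ) F = 0) := by
  refine ⟨chooseForm (.X 0) (.X 1) (.X 2) (.X 3) (.X 4) (.X 5) (.X 6) (.X 7) (.X 8) (.X 9)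
    (.X 10) (.X 11) (.X 12), fun y n s hs hsn => ?_⟩
  rw [eq_choose_iff_exists_chooseForm_eq_zero hs hsn]
  simp only [map_chooseForm, MvPolynomial.eval_X]
  rfl
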